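/- Let $\Omega$ be a compact metric space and let $\mu$ be a Borel probability measure on $\Omega$ with $\operatorname{supp}(\mu)=\Omega$. Let $K:\Omega\times\Omega\to\mathbb R$ be continuous and symmetric, i.e. $K(x,y)=K(y,x)$ for all $x,y\in\Omega$. We say that $K$ is positive definite if $$I_K(\nu)=\int_\Omega\int_\Omega K(x,y)\,d\nu(x)\,d\nu(y)\ \ge\ 0$$ for every finite signed Borel measure $\nu$ on $\Omega$. Then $K$ is positive definite if and only if there exists a symmetric function $k:\Omega\times\Omega\to\mathbb R$ (that is, $k(x,y)=k(y,x)$ for all $x,y\in\Omega$) with $k\in L^2(\Omega\times\Omega,\mu\times\mu)$ such that, for all $x,y\in\Omega$, the function $z\mapsto k(x,z)\,k(z,y)$ is $\mu$-integrable and $$K(x,y)=\int_\Omega k(x,z)\,k(z,y)\,d\mu(z).$$ -/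

import Mathlib

open MeasureTheory

/-- The energy `I_K(ν) = ∫∫ K(x,y) dν(x) dν(y)` of a finite signed measure `ν` on `Ω`. -/
noncomputable def kernelEnergy {Ω : Type*} [MeasurableSpace Ω] (K : Ω → Ω → ℝ)
    (ν : SignedMeasure Ω) : ℝ :=
  ∫ᵛ y, (∫ᵛ x, K x y ∂<•ν) ∂<•ν

/-- A (continuous symmetric) kernel `K` is positive definite if its energy is nonnegative at every
finite signed measure. (On a compact metric space every finite signed Borel measure is regular.) -/
def IsPositiveDefiniteKernel {Ω : Type*} [MeasurableSpace Ω] (K : Ω → Ω → ℝ) : Prop :=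
  ∀ ν : SignedMeasure Ω, 0 ≤ kernelEnergy K ν

/-! If `K` factors through `k`, then `∑ c x * c y * K x y = ∫ (∑ c x * k x z)² dμ(z) ≥ 0`, and every
energy is a limit of such sums (`kernelEnergy_nonneg_of_forall_sum_nonneg`).

Conversely, `k` should be the kernel `∑ √λᵢ φᵢ(x) φᵢ(z)` of the square root of the integral
operator. Mercer's expansion (`exists_mercer_expansion`) follows from testing the energy on `c δ_a -
g μ`. The series for `k` need not converge pointwise, yet the identity is required for all `x, y`.
By Dini, its sections converge in `L²(dz)` uniformly in `x`. Hence one fast sequence of partial sums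
converges for a.e. `z`, whatever `x` is, and its limsup is a symmetric measurable `k` with the right
sections (`exists_symmetric_measurable_section`). -/

/-! ### Energies: differences of measures and discretization. -/

section Energy

variable {Ω : Type*} [MeasurableSpace Ω]

lemma vectorMeasure_integral_toSignedMeasure_sub (ν₁ ν₂ : Measure Ω) [IsFiniteMeasure ν₁]
    [IsFiniteMeasure ν₂] {f : Ω → ℝ} (h₁ : Integrable f ν₁) (h₂ : Integrable f ν₂) :
    ∫ᵛ x, f x ∂<•(ν₁.toSignedMeasure - ν₂.toSignedMeasure) = ∫ x, f x ∂ν₁ - ∫ x, f x ∂ν₂ := by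
  rw [VectorMeasure.integral_sub_vectorMeasure, VectorMeasure.integral_toSignedMeasure,
    VectorMeasure.integral_toSignedMeasure]
  · simpa [VectorMeasure.Integrable] using h₁
  · simpa [VectorMeasure.Integrable] using h₂

variable [MetricSpace Ω] [CompactSpace Ω] [BorelSpace Ω]

lemma Continuous.integrable_of_compactSpace {ν : Measure Ω} [IsFiniteMeasure ν] {f : Ω → ℝ}
    (hf : Continuous f) : Integrable f ν :=
  integrableOn_univ.1 (hf.continuousOn.integrableOn_compact isCompact_univ)

lemma continuous_integral_kernel (ν : Measure Ω) [IsFiniteMeasure ν] {K : Ω → Ω → ℝ}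
    (hK : Continuous (Function.uncurry K)) : Continuous fun y => ∫ x, K x y ∂ν := by
  have := continuous_parametric_integral_of_continuous (μ := ν) (f := fun y x => K x y)
    (hK.comp continuous_swap) (s := Set.univ) isCompact_univ
  simpa using this

lemma kernelEnergy_toSignedMeasure_sub (ν₁ ν₂ : Measure Ω) [IsFiniteMeasure ν₁]
    [IsFiniteMeasure ν₂] {K : Ω → Ω → ℝ} (hK : Continuous (Function.uncurry K)) :
    kernelEnergy K (ν₁.toSignedMeasure - ν₂.toSignedMeasure) =
      ∫ y, (∫ x, K x y ∂ν₁ - ∫ x, K x y ∂ν₂) ∂ν₁ - ∫ y, (∫ x, K x y ∂ν₁ - ∫ x, K x y ∂ν₂) ∂ν₂ := by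
  have h : ∀ y, ∫ᵛ x, K x y ∂<•(ν₁.toSignedMeasure - ν₂.toSignedMeasure) =
      ∫ x, K x y ∂ν₁ - ∫ x, K x y ∂ν₂ := fun y =>
    vectorMeasure_integral_toSignedMeasure_sub ν₁ ν₂
      (hK.comp (.prodMk_left y)).integrable_of_compactSpace
      (hK.comp (.prodMk_left y)).integrable_of_compactSpace
  have hc := (continuous_integral_kernel ν₁ hK).sub (continuous_integral_kernel ν₂ hK)
  simp only [kernelEnergy, h]
  exact vectorMeasure_integral_toSignedMeasure_sub ν₁ ν₂ hc.integrable_of_compactSpace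
    hc.integrable_of_compactSpace

/-- The energy inequality for the signed measure `c δ_a - g μ`. -/
lemma IsPositiveDefiniteKernel.energy_dirac_sub_density_nonneg {K : Ω → Ω → ℝ}
    (hK : Continuous (Function.uncurry K)) (hpd : IsPositiveDefiniteKernel K) (μ : Measure Ω)
    [IsFiniteMeasure μ] (c : NNReal) (a : Ω) (g : C(Ω, ℝ)) :
    0 ≤ c * (c * K a a - ∫ x, K x a * g x ∂μ) -
      ∫ y, (c * K a y - ∫ x, K x y * g x ∂μ) * g y ∂μ := by
  -- Adding `M μ` to both parts makes them positive: `c δ_a - g μ = (c δ_a + (M - g) μ) - M μ`.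
  set M : ℝ := ‖g‖
  have hM : ∀ x, 0 ≤ M - g x := fun x => sub_nonneg.2 ((le_abs_self _).trans (g.norm_coe_le_norm x))
  set d : Ω → NNReal := fun x => (M - g x).toNNReal with hd
  have hdm : Continuous d := by fun_prop
  have hfin : IsFiniteMeasure (μ.withDensity fun x => d x) := by
    refine isFiniteMeasure_withDensity ?_
    have : Integrable (fun x => M - g x) μ :=
      (continuous_const.sub g.continuous).integrable_of_compactSpace
    exact (this.lintegral_lt_top).ne
  set ν₁ : Measure Ω := c • Measure.dirac a + μ.withDensity fun x => d x
  set ν₂ : Measure Ω := M.toNNReal • μ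
  have key : ∀ f : Ω → ℝ, Continuous f →
      ∫ x, f x ∂ν₁ - ∫ x, f x ∂ν₂ = c * f a - ∫ x, f x * g x ∂μ := by
    intro f hf
    rw [integral_add_measure hf.integrable_of_compactSpace hf.integrable_of_compactSpace,
      integral_smul_nnreal_measure, integral_smul_nnreal_measure, integral_dirac,
      integral_withDensity_eq_integral_smul hdm.measurable]
    have h1 : ∀ x, d x • f x = M * f x - f x * g x := fun x => by
      rw [NNReal.smul_def, smul_eq_mul, hd, Real.coe_toNNReal _ (hM x)]; ring
    simp only [h1]
    rw [integral_sub (by exact (hf.const_mul M).integrable_of_compactSpace)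
      (by exact (hf.mul g.continuous).integrable_of_compactSpace), integral_const_mul]
    simp only [NNReal.smul_def, smul_eq_mul, Real.coe_toNNReal M (norm_nonneg g)]
    ring
  have h := hpd (ν₁.toSignedMeasure - ν₂.toSignedMeasure)
  rw [kernelEnergy_toSignedMeasure_sub _ _ hK,
    key (fun y => ∫ x, K x y ∂ν₁ - ∫ x, K x y ∂ν₂)
      ((continuous_integral_kernel ν₁ hK).sub (continuous_integral_kernel ν₂ hK))] at h
  have hk := fun y => key (fun x => K x y) (hK.comp (.prodMk_left y))
  simpa only [hk] using h

open Filter Topology in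
-- Simple functions `φ n` converging pointwise to the identity push the measures to finitely many
-- atoms; dominated convergence applies because `K` is bounded.
lemma kernelEnergy_nonneg_of_forall_sum_nonneg {K : Ω → Ω → ℝ}
    (hK : Continuous (Function.uncurry K))
    (hfin : ∀ (s : Finset Ω) (c : Ω → ℝ), 0 ≤ ∑ x ∈ s, ∑ y ∈ s, c x * c y * K x y)
    (ν₁ ν₂ : Measure Ω) [IsFiniteMeasure ν₁] [IsFiniteMeasure ν₂] :
    0 ≤ kernelEnergy K (ν₁.toSignedMeasure - ν₂.toSignedMeasure) := by
  rw [kernelEnergy_toSignedMeasure_sub _ _ hK]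
  rcases isEmpty_or_nonempty Ω with _ | ⟨⟨a⟩⟩
  · simp [Measure.eq_zero_of_isEmpty]
  set φ : ℕ → SimpleFunc Ω Ω := fun n =>
    SimpleFunc.approxOn id measurable_id Set.univ a (Set.mem_univ a) n
  have hφ : ∀ x, Tendsto (fun n => φ n x) atTop (𝓝 x) := fun x =>
    SimpleFunc.tendsto_approxOn measurable_id (Set.mem_univ a) (by simp)
  obtain ⟨C, hC⟩ : ∃ C, ∀ x y, |K x y| ≤ C := by
    obtain ⟨C, hC⟩ := isCompact_univ.exists_bound_of_continuousOn hK.continuousOn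
    exact ⟨C, fun x y => hC (x, y) trivial⟩
  have hmap : ∀ (ν : Measure Ω) [IsFiniteMeasure ν] n (f : Ω → ℝ),
      ∫ x, f (φ n x) ∂ν = ∑ x ∈ (φ n).range, ν.real (φ n ⁻¹' {x}) * f x := by
    intro ν _ n f
    have hind : ∀ x, f (φ n x) =
        ∑ i ∈ (φ n).range, (φ n ⁻¹' {i}).indicator (fun _ => f i) x := fun x => by
      rw [Finset.sum_eq_single_of_mem (φ n x) (SimpleFunc.mem_range_self _ _)]
      · simp
      · intro i _ hi
        exact Set.indicator_of_notMem (fun h => hi h.symm) _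
    simp only [hind]
    rw [integral_finsetSum _ fun i _ =>
      (integrable_const (f i)).indicator ((φ n).measurableSet_fiber i)]
    refine Finset.sum_congr rfl fun i _ => ?_
    rw [integral_indicator_const _ ((φ n).measurableSet_fiber i), smul_eq_mul]
  have hin : ∀ (ν : Measure Ω) [IsFiniteMeasure ν] y,
      Tendsto (fun n => ∫ x, K (φ n x) (φ n y) ∂ν) atTop (𝓝 (∫ x, K x y ∂ν)) := by
    intro ν _ y
    refine tendsto_integral_of_dominated_convergence (fun _ => C) (fun n => ?_)
      (integrable_const C) (fun n => ae_of_all _ fun x => hC _ _) (ae_of_all _ fun x => ?_)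
    · exact ((φ n).map fun x => K x (φ n y)).aestronglyMeasurable
    · exact (hK.tendsto (x, y)).comp ((hφ x).prodMk_nhds (hφ y))
  have hbd : ∀ (ν : Measure Ω) [IsFiniteMeasure ν] n y,
      ‖∫ x, K (φ n x) (φ n y) ∂ν‖ ≤ C * ν.real Set.univ := fun ν _ n y =>
    norm_integral_le_of_norm_le_const (ae_of_all _ fun x => hC _ _)
  have hout : ∀ (ν : Measure Ω) [IsFiniteMeasure ν],
      Tendsto (fun n => ∫ y, (∫ x, K (φ n x) (φ n y) ∂ν₁ - ∫ x, K (φ n x) (φ n y) ∂ν₂) ∂ν) atTop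
        (𝓝 (∫ y, (∫ x, K x y ∂ν₁ - ∫ x, K x y ∂ν₂) ∂ν)) := by
    intro ν _
    refine tendsto_integral_of_dominated_convergence
      (fun _ => C * ν₁.real Set.univ + C * ν₂.real Set.univ) (fun n => ?_)
      (integrable_const _) (fun n => ae_of_all _ fun y => ?_) (ae_of_all _ fun y => ?_)
    · exact ((φ n).map fun y => ∫ x, K (φ n x) y ∂ν₁ - ∫ x, K (φ n x) y ∂ν₂).aestronglyMeasurable
    · exact (norm_sub_le _ _).trans (add_le_add (hbd ν₁ n y) (hbd ν₂ n y))
    · exact (hin ν₁ y).sub (hin ν₂ y)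
  refine ge_of_tendsto' ((hout ν₁).sub (hout ν₂)) fun n => ?_
  -- The weights of the atoms of the pushforward of `ν₁ - ν₂` under `φ n`.
  set c : Ω → ℝ := fun x => ν₁.real (φ n ⁻¹' {x}) - ν₂.real (φ n ⁻¹' {x}) with hc
  have hsub : ∀ f : Ω → ℝ, ∫ x, f (φ n x) ∂ν₁ - ∫ x, f (φ n x) ∂ν₂ =
      ∑ x ∈ (φ n).range, c x * f x := by
    intro f
    rw [hmap, hmap, ← Finset.sum_sub_distrib]
    exact Finset.sum_congr rfl fun x _ => by rw [hc]; ring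
  have hsub' := fun y => hsub fun x => K x y
  simp only [hsub']
  rw [hsub fun y => ∑ x ∈ (φ n).range, c x * K x y]
  refine (hfin (φ n).range c).trans_eq ?_
  rw [Finset.sum_comm]
  refine Finset.sum_congr rfl fun y _ => ?_
  rw [Finset.mul_sum]
  exact Finset.sum_congr rfl fun x _ => by ring

/-- A kernel of the form `∫ k(x,z) k(y,z) dμ(z)` is positive definite. -/
lemma isPositiveDefiniteKernel_of_factorization {K : Ω → Ω → ℝ}
    (hK : Continuous (Function.uncurry K)) (μ : Measure Ω) (k : Ω → Ω → ℝ)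
    (hint : ∀ x y, Integrable (fun z => k x z * k y z) μ)
    (hKk : ∀ x y, K x y = ∫ z, k x z * k y z ∂μ) : IsPositiveDefiniteKernel K := by
  intro ν
  rw [← SignedMeasure.toSignedMeasure_toJordanDecomposition ν, JordanDecomposition.toSignedMeasure]
  refine kernelEnergy_nonneg_of_forall_sum_nonneg hK (fun s c => ?_) _ _
  have : ∑ x ∈ s, ∑ y ∈ s, c x * c y * K x y = ∫ z, (∑ x ∈ s, c x * k x z) ^ 2 ∂μ := by
    have h : ∀ z, (∑ x ∈ s, c x * k x z) ^ 2 =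
        ∑ x ∈ s, ∑ y ∈ s, c x * c y * (k x z * k y z) := fun z => by
      rw [sq, Finset.sum_mul_sum]
      exact Finset.sum_congr rfl fun x _ => Finset.sum_congr rfl fun y _ => by ring
    simp only [h]
    rw [integral_finsetSum _ fun x _ => integrable_finsetSum _ fun y _ => (hint x y).const_mul _]
    refine Finset.sum_congr rfl fun x _ => ?_
    rw [integral_finsetSum _ fun y _ => (hint x y).const_mul _]
    exact Finset.sum_congr rfl fun y _ => by rw [integral_const_mul, hKk]
  rw [this]
  exact integral_nonneg fun z => sq_nonneg _

end Energy

/-! ### A jointly measurable choice of sections. -/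

open Filter Topology ENNReal in
/-- A family of `L²` functions that is uniformly approximated by the sections of symmetric
measurable functions consists of the sections of a single symmetric measurable function. -/
lemma exists_symmetric_measurable_section {Ω : Type*} [MeasurableSpace Ω] {μ : Measure Ω}
    (k : Ω → Ω → ℝ) (hk : ∀ x, AEStronglyMeasurable (k x) μ)
    (F : ℕ → Ω → Ω → ℝ) (hsymm : ∀ n x y, F n x y = F n y x)
    (hmeas : ∀ n, Measurable (Function.uncurry (F n)))
    (hF : ∀ n x, eLpNorm (F n x - k x) 2 μ < 2⁻¹ ^ n) :
    ∃ h : Ω → Ω → ℝ, Measurable (Function.uncurry h) ∧ (∀ x y, h x y = h y x) ∧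
      ∀ x, h x =ᵐ[μ] k x := by
  -- The limsup keeps symmetry and measurability at every point; its value matters only where the
  -- sequence converges.
  refine ⟨fun x y => limsup (fun n => F n x y) atTop, Measurable.limsup hmeas, fun x y => ?_,
    fun x => ?_⟩
  · simp only [hsymm _ x y]
  have hm : ∀ n, AEStronglyMeasurable (F n x) μ := fun n =>
    ((hmeas n).comp measurable_prodMk_left).aestronglyMeasurable
  have hgeom : ∑' n : ℕ, (2 * 2⁻¹ ^ n : ℝ≥0∞) ≠ ∞ := by
    rw [ENNReal.tsum_mul_left, ENNReal.tsum_geometric]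
    simp [ENNReal.mul_eq_top]
  have hlim : ∀ᵐ z ∂μ, ∃ l, Tendsto (fun n => F n x z) atTop (𝓝 l) := by
    refine Lp.ae_tendsto_of_cauchy_eLpNorm hm one_le_two hgeom fun N n m hn hm' => ?_
    have hle : ∀ j, N ≤ j → eLpNorm (F j x - k x) 2 μ < 2⁻¹ ^ N := fun j hj =>
      (hF j x).trans_le (pow_le_pow_right_of_le_one' (by simp) hj)
    calc eLpNorm (F n x - F m x) 2 μ = eLpNorm ((F n x - k x) - (F m x - k x)) 2 μ := by
          rw [sub_sub_sub_cancel_right]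
      _ ≤ eLpNorm (F n x - k x) 2 μ + eLpNorm (F m x - k x) 2 μ :=
          eLpNorm_sub_le ((hm n).sub (hk x)) ((hm m).sub (hk x)) one_le_two
      _ < 2⁻¹ ^ N + 2⁻¹ ^ N := ENNReal.add_lt_add (hle n hn) (hle m hm')
      _ = 2 * 2⁻¹ ^ N := (two_mul _).symm
  -- Almost everywhere convergence is known; a subsequence identifies the limit as `k x`.
  have htend : Tendsto (fun n => eLpNorm (F n x - k x) 2 μ) atTop (𝓝 0) :=
    tendsto_of_tendsto_of_tendsto_of_le_of_le tendsto_const_nhds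
      (ENNReal.tendsto_pow_atTop_nhds_zero_of_lt_one (by simp)) (fun _ => zero_le)
      fun n => (hF n x).le
  obtain ⟨ns, hns, hae⟩ :=
    (tendstoInMeasure_of_tendsto_eLpNorm two_ne_zero hm (hk x) htend).exists_seq_tendsto_ae
  filter_upwards [hlim, hae] with z ⟨l, hl⟩ hz
  rw [hl.limsup_eq]
  exact tendsto_nhds_unique (hl.comp hns.tendsto_atTop) hz

/-! ### Eigenbases of compact self-adjoint operators. -/

section Spectral

open Module.End

universe u

/-- A compact self-adjoint operator has a Hilbert basis of eigenvectors. -/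
lemma IsCompactOperator.exists_hilbertBasis_eigenvectors {H : Type u} [NormedAddCommGroup H]
    [InnerProductSpace ℝ H] [CompleteSpace H] {T : H →L[ℝ] H} (hT : IsCompactOperator T)
    (hsymm : (T : H →ₗ[ℝ] H).IsSymmetric) :
    ∃ (ι : Type u) (b : HilbertBasis ι ℝ H) (l : ι → ℝ), ∀ i, T (b i) = l i • b i := by
  have hE : ∀ l : ℝ, CompleteSpace (eigenspace (T : H →ₗ[ℝ] H) l) := fun l => by
    have : IsClosed (eigenspace (T : H →ₗ[ℝ] H) l : Set H) := by
      have : (eigenspace (T : H →ₗ[ℝ] H) l : Set H) = {x | T x = l • x} := by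
        ext x; exact mem_eigenspace_iff
      rw [this]
      exact isClosed_eq T.continuous (continuous_const_smul l)
    exact this.completeSpace_coe
  choose w β hβ using fun l : ℝ => exists_hilbertBasis ℝ (eigenspace (T : H →ₗ[ℝ] H) l)
  set v : (Σ l, w l) → H := fun a => (β a.1 a.2 : H) with hv
  have hon : Orthonormal ℝ v :=
    hsymm.orthogonalFamily_eigenspaces.orthonormal_sigma_orthonormal fun l => (β l).orthonormal
  have hbot : (Submodule.span ℝ (Set.range v))ᗮ = ⊥ := by
    rw [eq_bot_iff, ← ContinuousLinearMap.orthogonalComplement_iSup_eigenspaces_eq_bot hT hsymm]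
    intro x hx
    rw [Submodule.mem_orthogonal] at hx
    rw [← Submodule.iInf_orthogonal, Submodule.mem_iInf]
    intro l
    rw [Submodule.mem_orthogonal]
    intro u hu
    have h := ((β l).hasSum_repr ⟨u, hu⟩).mapL
      ((innerSL ℝ x).comp (eigenspace (T : H →ₗ[ℝ] H) l).subtypeL)
    have h0 : ∀ j, inner ℝ x (β l j : H) = 0 := fun j => by
      rw [real_inner_comm]
      exact hx _ (Submodule.subset_span ⟨⟨l, j⟩, rfl⟩)
    simp only [ContinuousLinearMap.comp_apply, map_smul, Submodule.subtypeL_apply,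
      innerSL_apply_apply, h0, smul_zero] at h
    rw [real_inner_comm]
    exact h.unique hasSum_zero
  refine ⟨Σ l, w l, HilbertBasis.mkOfOrthogonalEqBot hon hbot, fun a => a.1, fun a => ?_⟩
  rw [HilbertBasis.coe_mkOfOrthogonalEqBot]
  exact mem_eigenspace_iff.1 (β a.1 a.2).2

end Spectral

/-! ### Compactness of the integral operator. -/

section InnerMap

variable {X H : Type*} [TopologicalSpace X] [CompactSpace X] [NormedAddCommGroup H]
  [InnerProductSpace ℝ H]

/-- The operator `f ↦ (x ↦ ⟪Φ x, f⟫)` attached to a continuous map `Φ` into a Hilbert space. -/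
noncomputable def ContinuousMap.innerMap (Φ : C(X, H)) : H →L[ℝ] C(X, ℝ) :=
  LinearMap.mkContinuous
    { toFun := fun f => ⟨fun x => inner ℝ (Φ x) f, by fun_prop⟩
      map_add' := fun f g => by ext x; simp [inner_add_right]
      map_smul' := fun c f => by ext x; simp [inner_smul_right] }
    ‖Φ‖ fun f => by
      rw [ContinuousMap.norm_le _ (by positivity)]
      exact fun x => (norm_inner_le_norm _ _).trans
        (mul_le_mul_of_nonneg_right (Φ.norm_coe_le_norm x) (norm_nonneg f))

@[simp]
lemma ContinuousMap.innerMap_apply (Φ : C(X, H)) (f : H) (x : X) :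
    Φ.innerMap f x = inner ℝ (Φ x) f := rfl

open Topology Metric in
-- Arzelà–Ascoli: on the unit ball, `|⟪Φ x - Φ x₀, f⟫| ≤ ‖Φ x - Φ x₀‖` gives equicontinuity.
lemma ContinuousMap.isCompactOperator_innerMap (Φ : C(X, H)) : IsCompactOperator Φ.innerMap := by
  set e := ContinuousMap.isometryEquivBoundedOfCompact X ℝ
  set S : Set (BoundedContinuousFunction X ℝ) := (fun f => e (Φ.innerMap f)) '' closedBall 0 1
  have hS : IsCompact (closure S) := by
    refine BoundedContinuousFunction.arzela_ascoli (closedBall 0 ‖Φ‖)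
      (isCompact_closedBall _ _) S ?_ ?_
    · rintro _ x ⟨f, hf, rfl⟩
      rw [mem_closedBall_zero_iff] at hf ⊢
      exact (norm_inner_le_norm _ _).trans
        ((mul_le_of_le_one_right (norm_nonneg _) hf).trans (Φ.norm_coe_le_norm x))
    · intro x₀
      rw [Metric.equicontinuousAt_iff_right]
      intro ε hε
      filter_upwards [Metric.continuousAt_iff'.1 Φ.continuous.continuousAt ε hε]
      rintro x hx ⟨_, f, hf, rfl⟩
      rw [mem_closedBall_zero_iff] at hf
      change dist (inner ℝ (Φ x₀) f) (inner ℝ (Φ x) f) < ε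
      rw [Real.dist_eq, ← inner_sub_left]
      refine (abs_real_inner_le_norm _ _).trans_lt
        ((mul_le_of_le_one_right (norm_nonneg _) hf).trans_lt ?_)
      rwa [← dist_eq_norm, dist_comm]
  refine ⟨e.symm '' closure S, hS.image e.symm.continuous,
    Filter.mem_of_superset (closedBall_mem_nhds 0 one_pos) fun f hf => ?_⟩
  exact ⟨e (Φ.innerMap f), subset_closure ⟨f, hf, rfl⟩, e.symm_apply_apply _⟩

end InnerMap

/-! ### Mercer's expansion. -/

section Mercer

universe u

variable {Ω : Type u} [MetricSpace Ω] [CompactSpace Ω] [MeasurableSpace Ω] [BorelSpace Ω]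
  (μ : Measure Ω) [IsFiniteMeasure μ]

/-- The inclusion of the continuous functions into `L²`. -/
noncomputable abbrev continuousToL2 : C(Ω, ℝ) →L[ℝ] Lp ℝ 2 μ := ContinuousMap.toLp 2 μ ℝ

/-- The map `y ↦ K(·, y)` into `L²`. -/
noncomputable def kernelFeature {K : Ω → Ω → ℝ} (hK : Continuous (Function.uncurry K)) :
    C(Ω, Lp ℝ 2 μ) :=
  ⟨fun y => continuousToL2 μ ((ContinuousMap.mk (fun p : Ω × Ω => K p.2 p.1)
    (hK.comp continuous_swap)).curry y), by fun_prop⟩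

variable {K : Ω → Ω → ℝ} (hK : Continuous (Function.uncurry K))

lemma kernelFeature_ae (y : Ω) : kernelFeature μ hK y =ᵐ[μ] fun x => K x y :=
  ContinuousMap.coeFn_toLp μ _

/-- The integral operator with kernel `K`, from `L²` to the continuous functions. -/
noncomputable abbrev kernelOperator : Lp ℝ 2 μ →L[ℝ] C(Ω, ℝ) := (kernelFeature μ hK).innerMap

lemma kernelOperator_apply (f : Lp ℝ 2 μ) (y : Ω) :
    kernelOperator μ hK f y = ∫ x, K x y * f x ∂μ := by
  rw [ContinuousMap.innerMap_apply, L2.inner_def]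
  refine integral_congr_ae ?_
  filter_upwards [kernelFeature_ae μ hK y] with x hx
  rw [hx]
  exact mul_comm _ _

lemma kernelOperator_continuousToL2_apply (g : C(Ω, ℝ)) (y : Ω) :
    kernelOperator μ hK (continuousToL2 μ g) y = ∫ x, K x y * g x ∂μ := by
  rw [kernelOperator_apply]
  refine integral_congr_ae ?_
  filter_upwards [ContinuousMap.coeFn_toLp (p := 2) (𝕜 := ℝ) μ g] with x hx
  rw [hx]

lemma inner_continuousToL2_left (g : C(Ω, ℝ)) (f : Lp ℝ 2 μ) :
    inner ℝ (continuousToL2 μ g) f = ∫ x, g x * f x ∂μ := by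
  rw [L2.inner_def]
  refine integral_congr_ae ?_
  filter_upwards [ContinuousMap.coeFn_toLp (p := 2) (𝕜 := ℝ) μ g] with x hx
  rw [hx]
  exact mul_comm _ _

lemma inner_continuousToL2 (g f : C(Ω, ℝ)) :
    inner ℝ (continuousToL2 μ g) (continuousToL2 μ f) = ∫ x, g x * f x ∂μ := by
  rw [inner_continuousToL2_left]
  refine integral_congr_ae ?_
  filter_upwards [ContinuousMap.coeFn_toLp (p := 2) (𝕜 := ℝ) μ f] with x hx
  rw [hx]

lemma isSymmetric_kernelOperator (hsymm : ∀ x y, K x y = K y x) :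
    ((continuousToL2 μ ∘L kernelOperator μ hK : Lp ℝ 2 μ →L[ℝ] Lp ℝ 2 μ) :
      Lp ℝ 2 μ →ₗ[ℝ] Lp ℝ 2 μ).IsSymmetric := by
  intro f g
  change inner ℝ (continuousToL2 μ (kernelOperator μ hK f)) g =
    inner ℝ f (continuousToL2 μ (kernelOperator μ hK g))
  rw [real_inner_comm _ f, inner_continuousToL2_left, inner_continuousToL2_left]
  simp only [kernelOperator_apply, ← integral_mul_const]
  have hint : Integrable (fun p : Ω × Ω => K p.2 p.1 * f p.2 * g p.1) (μ.prod μ) := by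
    obtain ⟨C, hC⟩ := isCompact_univ.exists_bound_of_continuousOn hK.continuousOn
    have h := ((Lp.memLp g).integrable one_le_two).mul_prod ((Lp.memLp f).integrable one_le_two)
    have hb := h.bdd_mul (c := C) (f := fun p : Ω × Ω => K p.2 p.1)
      (hK.comp continuous_swap).aestronglyMeasurable (ae_of_all _ fun p => hC p.swap trivial)
    exact hb.congr (ae_of_all _ fun p => by ring)
  rw [integral_integral_swap hint]
  refine integral_congr_ae (ae_of_all _ fun x => integral_congr_ae (ae_of_all _ fun y => ?_))
  simp only [hsymm x y]
  ring

variable {μ hK}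

/-- The energy of `c δ_a - g μ`, expanded. Below, `c = 1` gives a Bessel inequality on the diagonal
and `c = 0` the sign of the eigenvalues. -/
lemma IsPositiveDefiniteKernel.kernelOperator_nonneg (hpd : IsPositiveDefiniteKernel K)
    (hsymm : ∀ x y, K x y = K y x) (c : NNReal) (a : Ω) (g : C(Ω, ℝ)) :
    0 ≤ c ^ 2 * K a a - 2 * c * kernelOperator μ hK (continuousToL2 μ g) a +
      inner ℝ (continuousToL2 μ (kernelOperator μ hK (continuousToL2 μ g)))
        (continuousToL2 μ g) := by
  have h := hpd.energy_dirac_sub_density_nonneg hK μ c a g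
  simp only [← kernelOperator_continuousToL2_apply μ hK] at h
  have hs : ∫ y, (c * K a y - kernelOperator μ hK (continuousToL2 μ g) y) * g y ∂μ =
      c * kernelOperator μ hK (continuousToL2 μ g) a -
        inner ℝ (continuousToL2 μ (kernelOperator μ hK (continuousToL2 μ g)))
        (continuousToL2 μ g) := by
    rw [inner_continuousToL2, kernelOperator_continuousToL2_apply, ← integral_const_mul,
      ← integral_sub]
    · exact integral_congr_ae (ae_of_all _ fun y => by simp only [hsymm a y]; ring)
    · refine Continuous.integrable_of_compactSpace ?_
      have := hK.comp (Continuous.prodMk_left a)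
      exact continuous_const.mul (this.mul g.continuous)
    · exact Continuous.integrable_of_compactSpace (by fun_prop)
  rw [hs] at h
  linarith

/-- Mercer's expansion of a positive definite kernel, in terms of an orthonormal family `b` of
eigenvectors with continuous representatives `φ`. -/
theorem IsPositiveDefiniteKernel.exists_mercer_expansion [μ.IsOpenPosMeasure]
    (hK : Continuous (Function.uncurry K)) (hpd : IsPositiveDefiniteKernel K)
    (hsymm : ∀ x y, K x y = K y x) :
    ∃ (ι : Type u) (b : HilbertBasis ι ℝ (Lp ℝ 2 μ)) (r : ι → ℝ) (φ : ι → C(Ω, ℝ)),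
      (∀ i x, φ i x • continuousToL2 μ (φ i) = φ i x • b i) ∧
      ∀ x y, HasSum (fun i => (r i * φ i x) * (r i * φ i y)) (K x y) := by
  set A := kernelOperator μ hK
  set J := continuousToL2 μ
  obtain ⟨ι, b, l, hb⟩ := IsCompactOperator.exists_hilbertBasis_eigenvectors (T := J ∘L A)
    ((kernelFeature μ hK).isCompactOperator_innerMap.clm_comp J)
    (isSymmetric_kernelOperator μ hK hsymm)
  replace hb : ∀ i, J (A (b i)) = l i • b i := hb
  have hJ : Function.Injective J := ContinuousMap.toLp_injective μ
  -- A continuous representative of `b i` if `l i ≠ 0`; otherwise `0`, since `0⁻¹ = 0`. The factor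
  -- `φ i x` in `hφJ` covers both cases.
  set φ : ι → C(Ω, ℝ) := fun i => (l i)⁻¹ • A (b i) with hφ
  have hlφ : ∀ i, A (b i) = l i • φ i := fun i => by
    rcases eq_or_ne (l i) 0 with h | h
    · rw [h, zero_smul]
      refine hJ ?_
      rw [hb, h, zero_smul, map_zero]
    · rw [hφ, smul_inv_smul₀ h]
  have hφ0 : ∀ i, l i = 0 → φ i = 0 := fun i h => by rw [hφ]; simp [h]
  have hφb : ∀ i, l i ≠ 0 → J (φ i) = b i := fun i h => by
    rw [hφ, map_smul, hb, inv_smul_smul₀ h]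
  have hφJ : ∀ i x, φ i x • J (φ i) = φ i x • b i := fun i x => by
    rcases eq_or_ne (l i) 0 with h | h
    · simp [hφ0 i h]
    · rw [hφb i h]
  have hbessel : ∀ x (s : Finset ι), ∑ i ∈ s, l i * φ i x ^ 2 ≤ K x x := by
    intro x s
    -- With `S = ∑ l i * φ i x ^ 2`, this choice of `g` yields `0 ≤ K x x - 2 S + S`.
    have h := hpd.kernelOperator_nonneg (μ := μ) (hK := hK) hsymm 1 x (∑ i ∈ s, φ i x • φ i)
    have hu : J (∑ i ∈ s, φ i x • φ i) = ∑ i ∈ s, φ i x • b i := by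
      rw [map_sum]
      exact Finset.sum_congr rfl fun i _ => by rw [map_smul, hφJ]
    have hA : A (∑ i ∈ s, φ i x • b i) = ∑ i ∈ s, (φ i x * l i) • φ i := by
      rw [map_sum]
      exact Finset.sum_congr rfl fun i _ => by rw [map_smul, hlφ, smul_smul]
    have hJA : J (∑ i ∈ s, (φ i x * l i) • φ i) = ∑ i ∈ s, (φ i x * l i) • b i := by
      rw [map_sum]
      exact Finset.sum_congr rfl fun i _ => by
        rw [map_smul, mul_comm, mul_smul, mul_smul, hφJ]
    rw [hu, hA, hJA, b.orthonormal.inner_sum] at h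
    simp only [NNReal.coe_one, one_pow, one_mul, mul_one, ContinuousMap.coe_sum,
      Finset.sum_apply, ContinuousMap.coe_smul, Pi.smul_apply, smul_eq_mul, conj_trivial] at h
    have e1 : ∑ i ∈ s, φ i x * l i * φ i x = ∑ i ∈ s, l i * φ i x ^ 2 :=
      Finset.sum_congr rfl fun i _ => by ring
    rw [e1] at h
    linarith
  have hl : ∀ i x, 0 ≤ l i * φ i x ^ 2 := fun i x => by
    rcases eq_or_ne (l i) 0 with h | h
    · simp [h]
    · have h2 := hpd.kernelOperator_nonneg (μ := μ) (hK := hK) hsymm 0 x (φ i)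
      change 0 ≤ _ - _ + inner ℝ (J (A (J (φ i)))) (J (φ i)) at h2
      rw [hφb i h, hb, real_inner_smul_left, real_inner_self_eq_norm_sq, b.orthonormal.1] at h2
      have : 0 ≤ l i := by simpa using h2
      positivity
  have hsq : ∀ i x y, (√(l i) * φ i x) * (√(l i) * φ i y) = l i * (φ i x * φ i y) := by
    intro i x y
    rcases le_or_gt 0 (l i) with h | h
    · rw [mul_mul_mul_comm, Real.mul_self_sqrt h]
    · have : φ i x = 0 := by
        have := hl i x
        by_contra h0
        have : 0 < φ i x ^ 2 := by positivity
        nlinarith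
      simp [this]
  refine ⟨ι, b, fun i => √(l i), φ, hφJ, fun x => ?_⟩
  simp only [hsq]
  obtain ⟨C, hC⟩ := isCompact_univ.exists_bound_of_continuousOn
    (hK.comp (continuous_id.prodMk continuous_id)).continuousOn
  replace hC : ∀ y, K y y ≤ C := fun y => (le_abs_self _).trans (hC y trivial)
  have hC0 : 0 ≤ C := (by simpa using hbessel x ∅ : 0 ≤ K x x).trans (hC x)
  have hsx : Summable fun i => l i * φ i x ^ 2 :=
    summable_of_sum_le (fun i => hl i x) (hbessel x)
  -- Cauchy–Schwarz bounds a block of the series by a small factor in `x` times a factor in `y` that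
  -- is at most `C`, hence uniformly in `y`.
  have hsum : Summable fun i => (l i * φ i x) • φ i := by
    rw [summable_iff_vanishing_norm]
    intro ε hε
    obtain ⟨s, hs⟩ := summable_iff_vanishing_norm.1 hsx (ε ^ 2 / (C + 1)) (by positivity)
    refine ⟨s, fun t ht => ?_⟩
    have h1 := (le_abs_self _).trans_lt (hs t ht)
    rw [ContinuousMap.norm_lt_iff _ hε]
    intro y
    simp only [ContinuousMap.coe_sum, Finset.sum_apply, ContinuousMap.coe_smul, Pi.smul_apply,
      smul_eq_mul]
    have h2 : (∑ i ∈ t, l i * φ i x * φ i y) ^ 2 ≤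
        (∑ i ∈ t, l i * φ i x ^ 2) * ∑ i ∈ t, l i * φ i y ^ 2 := by
      have := Finset.sum_mul_sq_le_sq_mul_sq t (fun i => √(l i) * φ i x) fun i => √(l i) * φ i y
      simpa only [sq (_ * _), hsq, ← sq, ← mul_assoc] using this
    rw [Real.norm_eq_abs, ← sq_lt_sq₀ (abs_nonneg _) hε.le, sq_abs]
    have h3 : 0 ≤ ∑ i ∈ t, l i * φ i y ^ 2 := Finset.sum_nonneg fun i _ => hl i y
    calc _ ≤ _ := h2
      _ ≤ ε ^ 2 / (C + 1) * C := mul_le_mul h1.le ((hbessel y t).trans (hC y)) h3 (by positivity)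
      _ < ε ^ 2 := by
        rw [div_mul_eq_mul_div, div_lt_iff₀ (by positivity)]
        nlinarith [sq_pos_of_pos hε]
  -- In `L²` the uniform limit equals `K(·, x)`; `J` is injective because `μ` charges open sets, so
  -- the equality is pointwise.
  have h1 := hsum.hasSum.mapL J
  have h2 := b.hasSum_repr (kernelFeature μ hK x)
  have h3 : ∀ i, J ((l i * φ i x) • φ i) = b.repr (kernelFeature μ hK x) i • b i := fun i => by
    rw [map_smul, mul_smul, hφJ, smul_smul, b.repr_apply_apply, real_inner_comm,
      ← ContinuousMap.innerMap_apply]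
    change _ = (A (b i)) x • b i
    rw [hlφ]; rfl
  simp only [h3] at h1
  have h4 := hJ (h1.unique h2)
  intro y
  have h5 := hsum.hasSum.mapL (ContinuousMap.evalCLM ℝ y)
  rw [h4] at h5
  simp only [ContinuousMap.evalCLM_apply, ContinuousMap.coe_smul, Pi.smul_apply, smul_eq_mul,
    mul_assoc] at h5
  rw [hsymm x y]
  exact h5

end Mercer

/-! ### The symmetric square root kernel. -/

/-- An expansion `K(x,y) = ∑ ψ i x * ψ i y` along a Hilbert basis `b` realizes `K` as the Gram
kernel of the vectors `∑ ψ i x • b i`. -/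
lemma HilbertBasis.exists_feature_of_hasSum {ι X H : Type*} [NormedAddCommGroup H]
    [InnerProductSpace ℝ H] (b : HilbertBasis ι ℝ H) {ψ : ι → X → ℝ} {K : X → X → ℝ}
    (hψ : ∀ x y, HasSum (fun i => ψ i x * ψ i y) (K x y)) :
    ∃ v : X → H, (∀ x y, inner ℝ (v x) (v y) = K x y) ∧
      ∀ x (s : Finset ι), ‖∑ i ∈ s, ψ i x • b i - v x‖ ^ 2 = K x x - ∑ i ∈ s, ψ i x ^ 2 := by
  have hmem : ∀ x, Memℓp (fun i => ψ i x) 2 := fun x => by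
    refine memℓp_gen ?_
    simpa [← sq] using (hψ x x).summable
  set v : X → H := fun x => b.repr.symm ⟨fun i => ψ i x, hmem x⟩ with hv
  have hbv : ∀ i x, inner ℝ (b i) (v x) = ψ i x := fun i x => by
    rw [← b.repr_apply_apply, hv, LinearIsometryEquiv.apply_symm_apply]
  have hinner : ∀ x y, inner ℝ (v x) (v y) = K x y := fun x y => by
    refine (b.hasSum_inner_mul_inner (v x) (v y)).unique ?_
    simpa only [real_inner_comm (b _) (v x), hbv] using hψ x y
  refine ⟨v, hinner, fun x s => ?_⟩
  rw [norm_sub_sq_real, ← real_inner_self_eq_norm_sq, ← real_inner_self_eq_norm_sq, hinner,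
    b.orthonormal.inner_sum, sum_inner]
  simp only [real_inner_smul_left, hbv, conj_trivial, ← sq]
  ring

section Factorization

variable {Ω : Type*} [MetricSpace Ω] [CompactSpace Ω] [MeasurableSpace Ω] [BorelSpace Ω]
  {μ : Measure Ω} [IsFiniteMeasure μ] {K : Ω → Ω → ℝ}

open Filter ENNReal in
/-- A positive definite kernel has a symmetric square root kernel, all of whose sections are
square integrable. -/
lemma IsPositiveDefiniteKernel.exists_symmetric_factorization [μ.IsOpenPosMeasure]
    (hK : Continuous (Function.uncurry K)) (hpd : IsPositiveDefiniteKernel K)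
    (hsymm : ∀ x y, K x y = K y x) :
    ∃ k : Ω → Ω → ℝ, Measurable (Function.uncurry k) ∧ (∀ x y, k x y = k y x) ∧
      ∀ x y, Integrable (fun z => k x z * k y z) μ ∧ K x y = ∫ z, k x z * k y z ∂μ := by
  obtain ⟨ι, b, r, φ, hφb, hexp⟩ := hpd.exists_mercer_expansion (μ := μ) hK hsymm
  obtain ⟨v, hv, hdist⟩ := b.exists_feature_of_hasSum hexp
  -- Dini: the partial sums increase to a continuous limit.
  have hunif : TendstoUniformly (fun (s : Finset ι) x => ∑ i ∈ s, (r i * φ i x) ^ 2)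
      (fun x => K x x) atTop := by
    refine Monotone.tendstoUniformly_of_forall_tendsto (fun s => by fun_prop)
      (fun s t hst x => Finset.sum_le_sum_of_subset_of_nonneg hst fun i _ _ => sq_nonneg _)
      (hK.comp (continuous_id.prodMk continuous_id)) fun x => ?_
    have h := hexp x x
    simp only [← sq] at h
    exact h
  -- The bound is squared because the left side is the squared `L²` distance in `hdist`.
  have hchoose : ∀ n : ℕ, ∃ s : Finset ι, ∀ x,
      K x x - ∑ i ∈ s, (r i * φ i x) ^ 2 < ((2⁻¹ : ℝ) ^ n) ^ 2 := fun n => by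
    obtain ⟨s, hs⟩ := (Metric.tendstoUniformly_iff.1 hunif (((2⁻¹ : ℝ) ^ n) ^ 2)
      (by positivity)).exists
    exact ⟨s, fun x => (le_abs_self _).trans_lt (hs x)⟩
  choose s hs using hchoose
  set F : ℕ → Ω → Ω → ℝ := fun n x z => ∑ i ∈ s n, r i * φ i x * φ i z with hF
  have hFcont : ∀ n, Continuous (Function.uncurry (F n)) := fun n => by
    simp only [hF, Function.uncurry_def]
    fun_prop
  have hFdist : ∀ n x, eLpNorm (F n x - ⇑(v x)) 2 μ < 2⁻¹ ^ n := by
    intro n x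
    set u : C(Ω, ℝ) := ∑ i ∈ s n, (r i * φ i x) • φ i with hu
    have hsum : continuousToL2 μ u = ∑ i ∈ s n, (r i * φ i x) • b i := by
      rw [hu, map_sum]
      exact Finset.sum_congr rfl fun i _ => by rw [map_smul, mul_smul, mul_smul, hφb]
    have hae : F n x - ⇑(v x) =ᵐ[μ] ⇑(continuousToL2 μ u - v x) := by
      filter_upwards [Lp.coeFn_sub (continuousToL2 μ u) (v x),
        ContinuousMap.coeFn_toLp (p := 2) (𝕜 := ℝ) μ u] with z hz hz'
      rw [hz, Pi.sub_apply, Pi.sub_apply, hz', hu]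
      simp [hF]
    have hnorm : ‖continuousToL2 μ u - v x‖ < 2⁻¹ ^ n := by
      rw [← sq_lt_sq₀ (norm_nonneg _) (by positivity), hsum, hdist]
      exact hs n x
    rw [eLpNorm_congr_ae hae, ← Lp.enorm_def, ← ofReal_norm]
    refine ((ENNReal.ofReal_lt_ofReal_iff (by positivity)).2 hnorm).trans_eq ?_
    rw [ENNReal.ofReal_pow (by positivity), ENNReal.ofReal_inv_of_pos two_pos]
    simp
  obtain ⟨k, hkm, hks, hkv⟩ := exists_symmetric_measurable_section (μ := μ) (fun x => v x)
    (fun x => Lp.aestronglyMeasurable _) F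
    (fun n x z => Finset.sum_congr rfl fun i _ => by ring) (fun n => (hFcont n).measurable) hFdist
  refine ⟨k, hkm, hks, fun x y => ?_⟩
  have hprod : (fun z => k x z * k y z) =ᵐ[μ] fun z => inner ℝ (v x z) (v y z) := by
    filter_upwards [hkv x, hkv y] with z hx hy
    rw [hx, hy]
    exact mul_comm _ _
  refine ⟨(L2.integrable_inner (v x) (v y)).congr hprod.symm, ?_⟩
  rw [integral_congr_ae hprod, ← L2.inner_def, hv]

/-- Tonelli: `∬ k² = ∫ K(x,x) dμ(x)`, finite since the diagonal is continuous. -/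
lemma memLp_two_uncurry_of_factorization (hK : Continuous (Function.uncurry K))
    {k : Ω → Ω → ℝ} (hk : Measurable (Function.uncurry k))
    (hint : ∀ x, Integrable (fun z => k x z * k x z) μ)
    (hKk : ∀ x, K x x = ∫ z, k x z * k x z ∂μ) :
    MemLp (Function.uncurry k) 2 (μ.prod μ) := by
  rw [memLp_two_iff_integrable_sq hk.aestronglyMeasurable,
    integrable_prod_iff (hk.pow_const 2).aestronglyMeasurable]
  simp only [Function.uncurry_apply_pair, Real.norm_eq_abs, abs_pow, sq_abs]
  simp only [sq, ← hKk]
  exact ⟨ae_of_all _ hint,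
    (hK.comp (continuous_id.prodMk continuous_id)).integrable_of_compactSpace⟩

end Factorization

theorem proposition2p15 {Ω : Type*} [MetricSpace Ω] [CompactSpace Ω]
    [MeasurableSpace Ω] [BorelSpace Ω]
    (μ : Measure Ω) [IsProbabilityMeasure μ] (hμ : μ.support = Set.univ)
    (K : Ω → Ω → ℝ) (hKcont : Continuous (Function.uncurry K))
    (hKsymm : ∀ x y, K x y = K y x) :
    IsPositiveDefiniteKernel K ↔
      ∃ k : Ω → Ω → ℝ,
        MemLp (Function.uncurry k) 2 (μ.prod μ) ∧
        (∀ x y, k x y = k y x) ∧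
        ∀ x y, Integrable (fun z => k x z * k z y) μ ∧
          K x y = ∫ z, k x z * k z y ∂μ := by
  constructor
  · intro hpd
    have : μ.IsOpenPosMeasure := ⟨fun U hU ⟨x, hx⟩ =>
      ((μ.mem_support_iff_forall x).1 (hμ ▸ Set.mem_univ x) U (hU.mem_nhds hx)).ne'⟩
    obtain ⟨k, hkm, hks, hk⟩ := hpd.exists_symmetric_factorization (μ := μ) hKcont hKsymm
    refine ⟨k, memLp_two_uncurry_of_factorization hKcont hkm (fun x => (hk x x).1)
      fun x => (hk x x).2, hks, fun x y => ?_⟩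
    simp only [hks _ y]
    exact hk x y
  · rintro ⟨k, -, hks, hk⟩
    exact isPositiveDefiniteKernel_of_factorization hKcont μ k
      (fun x y => by simpa only [hks _ y] using (hk x y).1)
      fun x y => by simpa only [hks _ y] using (hk x y).2
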